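/- **Conventions.** A *quandle* is a non-empty set $X$ with a binary operation $(x,y)\mapsto x^y$ such that $x^x=x$; for all $x,y$ there is a unique $z$, written $x^{y^{-1}}$, with $z^y=x$; and $(x^y)^z=(x^z)^{(y^z)}$. A quandle $Q$ is *connected* if for all $x,y\in Q$ there are $z_1,\dots,z_k\in Q$ and $\varepsilon_1,\dots,\varepsilon_k\in\{\pm1\}$ with $(\cdots(x^{z_1^{\varepsilon_1}})\cdots)^{z_k^{\varepsilon_k}}=y$. A *finite presentation* $Q=\langle x_1,\dots,x_n\mid r_1,\dots,r_m\rangle$ identifies $Q$ with the quotient of the free quandle $FQ$ on $x_1,\dots,x_n$ by the smallest congruence containing the pairs $r_i=(r_{i,1},r_{i,2})\in FQ^2$. A *quandle 2-cocycle* with values in an abelian group $A$ is a map $\theta:X^2\to A$ with $\theta(x,x)=0_A$ and $\theta(x,y)+\theta(x^y,z)=\theta(x,z)+\theta(x^z,y^z)$ for all $x,y,z\in X$. **Alexander matrix.** Let $\rho:Q\to X$ be a quandle homomorphism. Write $\bar w\in Q$ for the image of $w\in FQ$. For $1\le j\le n$ let $\partial_j:FQ\to\mathbb Z[A]$ be the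 unique map with $\partial_j(x_i)=\delta_{ij}$ and $\partial_j(u^v)=\bigl(1\cdot\theta(\rho(\bar u),\rho(\bar v))\bigr)\,\partial_j(u)$ for all $u,v\in FQ$, that is, the derivative for the Alexander pair $(f_\theta,0)$, $f_\theta(x,y)=1\cdot\theta(x,y)$, pulled back along $\rho$. The $m\times n$ matrix $A(Q,\rho;f_\theta,0)$ has entries $\partial_j(r_{i,1})-\partial_j(r_{i,2})$. The elementary ideal $E_0$ of an $m\times n$ matrix over a commutative ring with $n\geq 1$ is the ideal generated by its $n\times n$ minors; it is $0$ if $m<n$. **Homology.** Let $C_1^Q(X)=\mathbb Z[X]$, let $C_2^Q(X)$ be $\mathbb Z[X^2]$ modulo the span of the $(x,x)$, and let $C_3^Q(X)$ be $\mathbb Z[X^3]$ modulo the span of the $(x,x,y)$ and $(x,y,y)$. Put $\partial_2(x,y)=(x)-(x^y)$ and $\partial_3(x,y,z)=(x,z)-(x^y,z)-(x,y)+(x^z,y^z)$. Then $H_2^Q(X)=\ker\partial_2/\operatorname{im}\partial_3$. A homomorphism $\rho:Q\to X$ induces $\rho_*:H_2^Q(Q)\to H_2^Q(X)$, and the linear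 extension of a 2-cocycle $\theta$ induces a homomorphism $\theta:H_2^Q(X)\to A$. **Theorem.** Let $Q=\langle x_1,\dots,x_n\mid r_1,\dots,r_m\rangle$ be a finitely presented connected quandle, $X$ a quandle, $A$ an abelian group, $\theta:X^2\to A$ a quandle 2-cocycle and $\rho:Q\to X$ a quandle homomorphism. Then, in the group ring $\mathbb Z[A]$, $$E_0\bigl(A(Q,\rho;f_\theta,0)\bigr)=\bigl(\{\,1\cdot a-1\cdot 0_A \mid a\in\operatorname{Im}(\theta\circ\rho_*)\,\}\bigr),$$ where the right-hand side is the ideal generated by the displayed set and $\theta\circ\rho_*:H_2^Q(Q)\to A$. -/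

import Mathlib

open scoped Quandles

/-! Throughout, the right-handed quandle operations of the literature are written with the left
action of Mathlib: `x ^ y` is `y ◃ x` and `x ^ (y⁻¹)` is `y ◃⁻¹ x`. -/

namespace QuandleAlexander

/-! ### Free quandles -/

/-- Formal quandle words on a set of letters. -/
inductive PreFreeQuandle (S : Type*) : Type _ where
  | of (s : S) : PreFreeQuandle S
  | act (y x : PreFreeQuandle S) : PreFreeQuandle S
  | invAct (y x : PreFreeQuandle S) : PreFreeQuandle S

/-- The smallest congruence on formal words that forces the quandle axioms. -/
inductive PreFreeQuandle.Rel {S : Type*} : PreFreeQuandle S → PreFreeQuandle S → Prop where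
  | refl (x) : Rel x x
  | symm {x y} : Rel x y → Rel y x
  | trans {x y z} : Rel x y → Rel y z → Rel x z
  | act_congr {y y' x x'} : Rel y y' → Rel x x' → Rel (.act y x) (.act y' x')
  | invAct_congr {y y' x x'} : Rel y y' → Rel x x' → Rel (.invAct y x) (.invAct y' x')
  | fix (x) : Rel (.act x x) x
  | invAct_act (y x) : Rel (.invAct y (.act y x)) x
  | act_invAct (y x) : Rel (.act y (.invAct y x)) x
  | self_distrib (z y x) : Rel (.act z (.act y x)) (.act (.act z y) (.act z x))

/-- The setoid of `PreFreeQuandle.Rel`. -/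
def PreFreeQuandle.setoid (S : Type*) : Setoid (PreFreeQuandle S) where
  r := PreFreeQuandle.Rel
  iseqv := ⟨.refl, .symm, .trans⟩

/-- The free quandle on `S`. -/
def FreeQuandle (S : Type*) : Type _ := Quotient (PreFreeQuandle.setoid S)

namespace FreeQuandle

instance instQuandle (S : Type*) : Quandle (FreeQuandle S) where
  act := Quotient.map₂ PreFreeQuandle.act fun _ _ h _ _ h' => .act_congr h h'
  invAct := Quotient.map₂ PreFreeQuandle.invAct fun _ _ h _ _ h' => .invAct_congr h h'
  self_distrib := by
    rintro ⟨z⟩ ⟨y⟩ ⟨x⟩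
    exact Quotient.sound (.self_distrib z y x)
  left_inv := by
    rintro ⟨y⟩ ⟨x⟩
    exact Quotient.sound (.invAct_act y x)
  right_inv := by
    rintro ⟨y⟩ ⟨x⟩
    exact Quotient.sound (.act_invAct y x)
  fix := by
    rintro ⟨x⟩
    exact Quotient.sound (.fix x)

/-- The canonical map `S → FQ(S)`. -/
def of {S : Type*} (s : S) : FreeQuandle S := Quotient.mk _ (.of s)

/-- Evaluation of formal words in a quandle. -/
def liftAux {S X : Type*} [Quandle X] (g : S → X) : PreFreeQuandle S → X
  | .of s => g s
  | .act y x => liftAux g y ◃ liftAux g x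
  | .invAct y x => liftAux g y ◃⁻¹ liftAux g x

theorem liftAux_rel {S X : Type*} [Quandle X] (g : S → X) {x y : PreFreeQuandle S}
    (h : PreFreeQuandle.Rel x y) : liftAux g x = liftAux g y := by
  induction h with
  | refl => rfl
  | symm _ ih => exact ih.symm
  | trans _ _ ih ih' => exact ih.trans ih'
  | act_congr _ _ ih ih' => simp only [liftAux, ih, ih']
  | invAct_congr _ _ ih ih' => simp only [liftAux, ih, ih']
  | fix => simp only [liftAux, Quandle.fix]
  | invAct_act y x => exact Rack.left_inv _ _
  | act_invAct y x => exact Rack.right_inv _ _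
  | self_distrib => exact Shelf.self_distrib

/-- The homomorphism `FQ(S) → X` extending a map `S → X`. -/
def lift {S X : Type*} [Quandle X] (g : S → X) : FreeQuandle S →◃ X where
  toFun := Quotient.lift (liftAux g) fun _ _ h => liftAux_rel g h
  map_act' := by
    rintro ⟨y⟩ ⟨x⟩
    rfl

theorem lift_of {S X : Type*} [Quandle X] (g : S → X) (s : S) : lift g (of s) = g s := rfl

theorem map_invAct {X Y : Type*} [Quandle X] [Quandle Y] (h : X →◃ Y) (y x : X) :
    h (y ◃⁻¹ x) = h y ◃⁻¹ h x := by
  rw [← Rack.left_cancel (h y), ← h.map_act, Rack.right_inv, Rack.right_inv]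

/-- Together with `lift_of`: the universal property of the free quandle. -/
theorem hom_ext {S X : Type*} [Quandle X] {g h : FreeQuandle S →◃ X}
    (hs : ∀ s, g (of s) = h (of s)) : g = h := by
  apply DFunLike.coe_injective
  funext w
  obtain ⟨w⟩ := w
  induction w with
  | of s => exact hs s
  | act y x ihy ihx =>
    have e : (Quot.mk _ (.act y x) : FreeQuandle S)
      = ((Quot.mk _ y : FreeQuandle S) ◃ (Quot.mk _ x : FreeQuandle S) : FreeQuandle S) := rfl
    erw [e, g.map_act, h.map_act, ihy, ihx]
  | invAct y x ihy ihx =>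
    have e : (Quot.mk _ (.invAct y x) : FreeQuandle S)
      = ((Quot.mk _ y : FreeQuandle S) ◃⁻¹ (Quot.mk _ x : FreeQuandle S) : FreeQuandle S) := rfl
    erw [e, map_invAct g, map_invAct h, ihy, ihx]

end FreeQuandle

/-! ### Presentations -/

/-- The smallest congruence on `FQ(S)` containing a family of relators. -/
inductive RelatorCongr {S ι : Type*} (r : ι → FreeQuandle S × FreeQuandle S) :
    FreeQuandle S → FreeQuandle S → Prop where
  | rel (i : ι) : RelatorCongr r (r i).1 (r i).2
  | refl (x) : RelatorCongr r x x
  | symm {x y} : RelatorCongr r x y → RelatorCongr r y x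
  | trans {x y z} : RelatorCongr r x y → RelatorCongr r y z → RelatorCongr r x z
  | act_congr {y y' x x'} : RelatorCongr r y y' → RelatorCongr r x x' →
      RelatorCongr r (y ◃ x) (y' ◃ x')
  | invAct_congr {y y' x x'} : RelatorCongr r y y' → RelatorCongr r x x' →
      RelatorCongr r (y ◃⁻¹ x) (y' ◃⁻¹ x')

/-- The setoid of `RelatorCongr r`. -/
def relatorSetoid {S ι : Type*} (r : ι → FreeQuandle S × FreeQuandle S) :
    Setoid (FreeQuandle S) where
  r := RelatorCongr r
  iseqv := ⟨.refl, .symm, .trans⟩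

/-- The quandle `⟨S | R⟩ = FQ(S) / ∼_R`. -/
def PresentedQuandle {S ι : Type*} (r : ι → FreeQuandle S × FreeQuandle S) : Type _ :=
  Quotient (relatorSetoid r)

instance PresentedQuandle.instQuandle {S ι : Type*} (r : ι → FreeQuandle S × FreeQuandle S) :
    Quandle (PresentedQuandle r) where
  act := Quotient.map₂ (fun y x => y ◃ x) fun _ _ h _ _ h' => .act_congr h h'
  invAct := Quotient.map₂ (fun y x => y ◃⁻¹ x) fun _ _ h _ _ h' => .invAct_congr h h'
  self_distrib := by
    rintro ⟨z⟩ ⟨y⟩ ⟨x⟩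
    exact congrArg (Quotient.mk (relatorSetoid r)) Shelf.self_distrib
  left_inv := by
    rintro ⟨y⟩ ⟨x⟩
    exact congrArg (Quotient.mk (relatorSetoid r)) (Rack.left_inv y x)
  right_inv := by
    rintro ⟨y⟩ ⟨x⟩
    exact congrArg (Quotient.mk (relatorSetoid r)) (Rack.right_inv y x)
  fix := by
    rintro ⟨x⟩
    exact congrArg (Quotient.mk (relatorSetoid r)) Quandle.fix

/-- A finite presentation `⟨x_1, …, x_n | r_1, …, r_m⟩` of the quandle `Q`. -/
structure FinitePresentation (Q : Type*) [Quandle Q] where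
  /-- The number of generators. -/
  n : ℕ
  /-- The number of relators. -/
  m : ℕ
  /-- The relators. -/
  rel : Fin m → FreeQuandle (Fin n) × FreeQuandle (Fin n)
  /-- The identification of the presented quandle with `Q`. -/
  iso : PresentedQuandle rel ≃ Q
  map_act : ∀ y x, iso (y ◃ x) = iso y ◃ iso x

/-- The element of `Q` represented by the `i`-th generator. -/
def FinitePresentation.gen {Q : Type*} [Quandle Q] (P : FinitePresentation Q) (i : Fin P.n) : Q :=
  P.iso (Quotient.mk (relatorSetoid P.rel) (FreeQuandle.of i))

/-! ### Alexander pairs, derivatives and Alexander matrices -/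

/-- An Alexander pair of maps `X² → R`. -/
structure AlexanderPair (X R : Type*) [Quandle X] [Ring R] where
  f₁ : X → X → R
  f₂ : X → X → R
  add_self : ∀ x, f₁ x x + f₂ x x = 1
  isUnit : ∀ x y, IsUnit (f₁ x y)
  cocycle₁ : ∀ x y z, f₁ (y ◃ x) z * f₁ x y = f₁ (z ◃ x) (z ◃ y) * f₁ x z
  cocycle₂ : ∀ x y z, f₁ (y ◃ x) z * f₂ x y = f₂ (z ◃ x) (z ◃ y) * f₁ y z
  cocycle₃ : ∀ x y z,
    f₂ (y ◃ x) z = f₁ (z ◃ x) (z ◃ y) * f₂ x z + f₂ (z ◃ x) (z ◃ y) * f₂ y z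

namespace AlexanderPair

/-- The Alexander pair `f ∘ ρ²`. -/
def comp {Q X R : Type*} [Quandle Q] [Quandle X] [Ring R] (f : AlexanderPair X R) (ρ : Q →◃ X) :
    AlexanderPair Q R where
  f₁ x y := f.f₁ (ρ x) (ρ y)
  f₂ x y := f.f₂ (ρ x) (ρ y)
  add_self x := f.add_self _
  isUnit x y := f.isUnit _ _
  cocycle₁ x y z := by simpa using f.cocycle₁ (ρ x) (ρ y) (ρ z)
  cocycle₂ x y z := by simpa using f.cocycle₂ (ρ x) (ρ y) (ρ z)
  cocycle₃ x y z := by simpa using f.cocycle₃ (ρ x) (ρ y) (ρ z)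

/-- The set `X × R` with the quandle operation
`(x, a) ^ (y, b) = (x ^ y, f₁(x, y) a + f₂(x, y) b)`. -/
@[ext]
structure Extension {X R : Type*} [Quandle X] [Ring R] (f : AlexanderPair X R) where
  base : X
  coef : R

noncomputable instance Extension.instQuandle {X R : Type*} [Quandle X] [Ring R]
    (f : AlexanderPair X R) : Quandle f.Extension where
  act y x := ⟨y.base ◃ x.base, f.f₁ x.base y.base * x.coef + f.f₂ x.base y.base * y.coef⟩
  invAct y x := ⟨y.base ◃⁻¹ x.base, Ring.inverse (f.f₁ (y.base ◃⁻¹ x.base) y.base) *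
    (x.coef - f.f₂ (y.base ◃⁻¹ x.base) y.base * y.coef)⟩
  self_distrib := by
    rintro ⟨z, c⟩ ⟨y, b⟩ ⟨x, a⟩
    ext
    · exact Shelf.self_distrib
    · simp only [mul_add, ← mul_assoc, f.cocycle₁ x y z, f.cocycle₂ x y z, f.cocycle₃ x y z,
        add_mul]
      abel
  left_inv := by
    rintro ⟨y, b⟩ ⟨x, a⟩
    ext
    · exact Rack.left_inv y x
    · simp only [Rack.left_inv y x, add_sub_cancel_right]
      rw [← mul_assoc, Ring.inverse_mul_cancel _ (f.isUnit x y), one_mul]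
  right_inv := by
    rintro ⟨y, b⟩ ⟨x, a⟩
    ext
    · exact Rack.right_inv y x
    · simp only
      rw [← mul_assoc, Ring.mul_inverse_cancel _ (f.isUnit _ y), one_mul, sub_add_cancel]
  fix := by
    rintro ⟨x, a⟩
    ext
    · exact Quandle.fix
    · simp only
      rw [← add_mul, f.add_self, one_mul]

end AlexanderPair

/-- The `f`-derivative `∂_f/∂x_j : FQ(S) → R`, where `f` is an Alexander pair on a quandle `Q` and
`p : S → Q` gives the images of the letters. It is the map determined by the two rules
`derivative_act` and `derivative_of`, see `eq_derivative`. -/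
noncomputable def derivative {S Q R : Type*} [DecidableEq S] [Quandle Q] [Ring R]
    (f : AlexanderPair Q R) (p : S → Q) (j : S) (w : FreeQuandle S) : R :=
  (FreeQuandle.lift (X := f.Extension) (fun s => ⟨p s, if s = j then 1 else 0⟩) w).coef

section derivative

variable {S Q R : Type*} [Quandle Q] [Ring R] (f : AlexanderPair Q R)

theorem lift_base (p : S → Q) (c : S → R) (w : FreeQuandle S) :
    (FreeQuandle.lift (X := f.Extension) (fun s => ⟨p s, c s⟩) w).base
      = FreeQuandle.lift p w := by
  let π : f.Extension →◃ Q := ⟨fun x => x.base, rfl⟩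
  have h : π.comp (FreeQuandle.lift (X := f.Extension) (fun s => ⟨p s, c s⟩))
      = FreeQuandle.lift p := FreeQuandle.hom_ext fun _ => rfl
  exact DFunLike.congr_fun h w

theorem derivative_of [DecidableEq S] (p : S → Q) (j s : S) :
    derivative f p j (FreeQuandle.of s) = if s = j then 1 else 0 := rfl

theorem derivative_act [DecidableEq S] (p : S → Q) (j : S) (y x : FreeQuandle S) :
    derivative f p j (y ◃ x) =
      f.f₁ (FreeQuandle.lift p x) (FreeQuandle.lift p y) * derivative f p j x +
      f.f₂ (FreeQuandle.lift p x) (FreeQuandle.lift p y) * derivative f p j y := by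
  unfold derivative
  rw [ShelfHom.map_act, ← lift_base f p (fun s => if s = j then 1 else 0) x,
    ← lift_base f p (fun s => if s = j then 1 else 0) y]
  rfl

theorem eq_derivative [DecidableEq S] (p : S → Q) (j : S) (D : FreeQuandle S → R)
    (hof : ∀ s, D (FreeQuandle.of s) = if s = j then 1 else 0)
    (hact : ∀ y x, D (y ◃ x) = f.f₁ (FreeQuandle.lift p x) (FreeQuandle.lift p y) * D x +
      f.f₂ (FreeQuandle.lift p x) (FreeQuandle.lift p y) * D y) :
    D = derivative f p j := by
  let F : FreeQuandle S →◃ f.Extension :=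
    ⟨fun w => ⟨FreeQuandle.lift p w, D w⟩, by
      intro y x
      apply AlexanderPair.Extension.ext
      · exact ShelfHom.map_act _
      · exact hact y x⟩
  have h : F = FreeQuandle.lift (X := f.Extension) (fun s => ⟨p s, if s = j then 1 else 0⟩) :=
    FreeQuandle.hom_ext fun s => AlexanderPair.Extension.ext rfl (hof s)
  funext w
  exact congrArg (fun e => e.coef) (DFunLike.congr_fun h w)

end derivative

/-- The `f`-twisted Alexander matrix `A(Q, ρ; f₁, f₂)` with respect to a finite presentation
of `Q`; the derivatives are taken with respect to `f ∘ ρ²`. -/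
noncomputable def alexanderMatrix {Q X R : Type*} [Quandle Q] [Quandle X] [Ring R]
    (P : FinitePresentation Q) (ρ : Q →◃ X) (f : AlexanderPair X R) :
    Matrix (Fin P.m) (Fin P.n) R :=
  Matrix.of fun i j =>
    derivative (f.comp ρ) P.gen j (P.rel i).1 - derivative (f.comp ρ) P.gen j (P.rel i).2

/-- The `d`-th elementary ideal `E_d(M)` of an `m × n` matrix. -/
def elementaryIdeal {R : Type*} [CommRing R] {m n : ℕ} (d : ℕ) (M : Matrix (Fin m) (Fin n) R) :
    Ideal R :=
  if n ≤ d then ⊤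
  else if d + m < n then ⊥
  else Ideal.span {x | ∃ (r : Fin (n - d) ↪o Fin m) (c : Fin (n - d) ↪o Fin n),
    x = (M.submatrix r c).det}

/-! ### Quandle 2-cocycles and the second quandle homology group -/

/-- `θ : X² → A` is a quandle 2-cocycle. -/
structure IsQuandleTwoCocycle {X A : Type*} [Quandle X] [AddCommGroup A] (θ : X → X → A) :
    Prop where
  self : ∀ x, θ x x = 0
  cocycle : ∀ x y z, θ x y + θ (y ◃ x) z = θ x z + θ (z ◃ x) (z ◃ y)

/-- The Alexander pair `(f_θ, 0)` with values in the group ring `ℤ[A]`,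
where `f_θ(x, y) = 1 · θ(x, y)`. -/
noncomputable def cocyclePair {X A : Type*} [Quandle X] [AddCommGroup A] {θ : X → X → A}
    (hθ : IsQuandleTwoCocycle θ) : AlexanderPair X (AddMonoidAlgebra ℤ A) where
  f₁ x y := AddMonoidAlgebra.single (θ x y) 1
  f₂ _ _ := 0
  add_self x := by rw [hθ.self, add_zero]; rfl
  isUnit x y := by
    refine IsUnit.of_mul_eq_one (AddMonoidAlgebra.single (-θ x y) 1) ?_
    rw [AddMonoidAlgebra.single_mul_single, add_neg_cancel, mul_one]
    rfl
  cocycle₁ x y z := by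
    rw [AddMonoidAlgebra.single_mul_single, AddMonoidAlgebra.single_mul_single,
      add_comm, hθ.cocycle, add_comm]
  cocycle₂ x y z := by simp
  cocycle₃ x y z := by simp

/-- `Q` is connected: any `x` can be brought to any `y` by a word `x ^ (z₁^ε₁ ⋯ z_k^ε_k)`; the
entry `(z, true)` stands for `z` and `(z, false)` for `z⁻¹`. -/
def IsConnected (Q : Type*) [Quandle Q] : Prop :=
  ∀ x y : Q, ∃ l : List (Q × Bool),
    l.foldl (fun a z => if z.2 then z.1 ◃ a else z.1 ◃⁻¹ a) x = y

section homology

variable (X : Type*) [Quandle X]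

/-- `∂₂ : C₂^R(X) → C₁^R(X)`, `(x, y) ↦ (x) - (x^y)`. -/
noncomputable def rackBoundary₂ : (X × X →₀ ℤ) →ₗ[ℤ] (X →₀ ℤ) :=
  Finsupp.lift _ ℤ _ fun q => Finsupp.single q.1 1 - Finsupp.single (q.2 ◃ q.1) 1

/-- `∂₃ : C₃^R(X) → C₂^R(X)`,
`(x, y, z) ↦ (x, z) - (x^y, z) - (x, y) + (x^z, y^z)`. -/
noncomputable def rackBoundary₃ : (X × X × X →₀ ℤ) →ₗ[ℤ] (X × X →₀ ℤ) :=
  Finsupp.lift _ ℤ _ fun q =>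
    (Finsupp.single (q.1, q.2.2) 1 - Finsupp.single (q.2.1 ◃ q.1, q.2.2) 1)
      - (Finsupp.single (q.1, q.2.1) 1 - Finsupp.single (q.2.2 ◃ q.1, q.2.2 ◃ q.2.1) 1)

theorem rackBoundary₂_single (x y : X) : rackBoundary₂ X (Finsupp.single (x, y) 1) =
    Finsupp.single x 1 - Finsupp.single (y ◃ x) 1 := by
  simp [rackBoundary₂]

theorem rackBoundary₃_single (x y z : X) : rackBoundary₃ X (Finsupp.single (x, y, z) 1) =
    (Finsupp.single (x, z) 1 - Finsupp.single (y ◃ x, z) 1)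
      - (Finsupp.single (x, y) 1 - Finsupp.single (z ◃ x, z ◃ y) 1) := by
  simp [rackBoundary₃]

/-- The degenerate chains `C₂^D(X)`. -/
noncomputable def degenerate₂ : Submodule ℤ (X × X →₀ ℤ) :=
  Submodule.span ℤ {c | ∃ x, c = Finsupp.single (x, x) 1}

/-- The degenerate chains `C₃^D(X)`. -/
noncomputable def degenerate₃ : Submodule ℤ (X × X × X →₀ ℤ) :=
  Submodule.span ℤ {c | ∃ x y z, (x = y ∨ y = z) ∧ c = Finsupp.single (x, y, z) 1}

theorem degenerate₂_le : degenerate₂ X ≤ LinearMap.ker (rackBoundary₂ X) := by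
  refine Submodule.span_le.2 ?_
  rintro _ ⟨x, rfl⟩
  simp [rackBoundary₂]

theorem degenerate₃_le : degenerate₃ X ≤ (degenerate₂ X).comap (rackBoundary₃ X) := by
  refine Submodule.span_le.2 ?_
  rintro _ ⟨x, y, z, h, rfl⟩
  have hd : ∀ a : X, Finsupp.single (a, a) (1 : ℤ) ∈ degenerate₂ X :=
    fun a => Submodule.subset_span ⟨a, rfl⟩
  rcases h with rfl | rfl
  · simpa [rackBoundary₃] using (degenerate₂ X).sub_mem (hd (z ◃ x)) (hd x)
  · simp [rackBoundary₃]

/-- The quandle chain group `C₂^Q(X) = C₂^R(X) / C₂^D(X)`. (Since there are no degenerate chains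
in degree one, `C₁^Q(X) = C₁^R(X)`.) -/
abbrev QuandleChain₂ : Type _ := (X × X →₀ ℤ) ⧸ degenerate₂ X

/-- The quandle chain group `C₃^Q(X) = C₃^R(X) / C₃^D(X)`. -/
abbrev QuandleChain₃ : Type _ := (X × X × X →₀ ℤ) ⧸ degenerate₃ X

/-- `∂₂ : C₂^Q(X) → C₁^Q(X)`. -/
noncomputable def quandleBoundary₂ : QuandleChain₂ X →ₗ[ℤ] (X →₀ ℤ) :=
  (degenerate₂ X).liftQ (rackBoundary₂ X) (degenerate₂_le X)

/-- `∂₃ : C₃^Q(X) → C₂^Q(X)`. -/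
noncomputable def quandleBoundary₃ : QuandleChain₃ X →ₗ[ℤ] QuandleChain₂ X :=
  (degenerate₃ X).mapQ (degenerate₂ X) (rackBoundary₃ X) (degenerate₃_le X)

theorem rackBoundary_comp : rackBoundary₂ X ∘ₗ rackBoundary₃ X = 0 := by
  apply Finsupp.lhom_ext'
  rintro ⟨x, y, z⟩
  apply LinearMap.ext_ring
  simp only [LinearMap.comp_apply, Finsupp.lsingle_apply, rackBoundary₃_single, map_sub,
    rackBoundary₂_single, LinearMap.zero_apply, ← Shelf.self_distrib]
  abel

theorem quandleBoundary_comp : quandleBoundary₂ X ∘ₗ quandleBoundary₃ X = 0 := by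
  apply Submodule.linearMap_qext
  exact rackBoundary_comp X

/-- The second quandle homology group `H₂^Q(X) = Ker ∂₂ / Im ∂₃`. -/
abbrev QuandleH₂ : Type _ :=
  LinearMap.ker (quandleBoundary₂ X) ⧸
    (LinearMap.range (quandleBoundary₃ X)).submoduleOf (LinearMap.ker (quandleBoundary₂ X))

end homology

section maps

variable {Q X A : Type*} [Quandle Q] [Quandle X] [AddCommGroup A]

/-- The map `C₂^Q(Q) → C₂^Q(X)`, `(x, y) ↦ (ρ(x), ρ(y))`. -/
noncomputable def chainMap₂ (ρ : Q →◃ X) : QuandleChain₂ Q →ₗ[ℤ] QuandleChain₂ X :=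
  (degenerate₂ Q).mapQ (degenerate₂ X) (Finsupp.lmapDomain ℤ ℤ (Prod.map ρ ρ)) (by
    refine Submodule.span_le.2 ?_
    rintro _ ⟨x, rfl⟩
    exact Submodule.subset_span ⟨ρ x, by simp⟩)

/-- The map `C₃^Q(Q) → C₃^Q(X)`, `(x, y, z) ↦ (ρ(x), ρ(y), ρ(z))`. -/
noncomputable def chainMap₃ (ρ : Q →◃ X) : QuandleChain₃ Q →ₗ[ℤ] QuandleChain₃ X :=
  (degenerate₃ Q).mapQ (degenerate₃ X)
    (Finsupp.lmapDomain ℤ ℤ (Prod.map ρ (Prod.map ρ ρ))) (by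
    refine Submodule.span_le.2 ?_
    rintro _ ⟨x, y, z, h, rfl⟩
    exact Submodule.subset_span
      ⟨ρ x, ρ y, ρ z, h.imp (congrArg ρ) (congrArg ρ), by simp⟩)

theorem quandleBoundary₂_chainMap (ρ : Q →◃ X) :
    quandleBoundary₂ X ∘ₗ chainMap₂ ρ = Finsupp.lmapDomain ℤ ℤ ρ ∘ₗ quandleBoundary₂ Q := by
  apply Submodule.linearMap_qext
  have h : rackBoundary₂ X ∘ₗ Finsupp.lmapDomain ℤ ℤ (Prod.map ρ ρ) =
      Finsupp.lmapDomain ℤ ℤ ρ ∘ₗ rackBoundary₂ Q := by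
    apply Finsupp.lhom_ext'
    rintro ⟨x, y⟩
    apply LinearMap.ext_ring
    simp only [LinearMap.comp_apply, Finsupp.lsingle_apply, Finsupp.lmapDomain_apply,
      Finsupp.mapDomain_single, Prod.map_apply, rackBoundary₂_single, Finsupp.mapDomain_sub,
      ShelfHom.map_act]
  exact h

theorem quandleBoundary₃_chainMap (ρ : Q →◃ X) :
    quandleBoundary₃ X ∘ₗ chainMap₃ ρ = chainMap₂ ρ ∘ₗ quandleBoundary₃ Q := by
  apply Submodule.linearMap_qext
  have h : rackBoundary₃ X ∘ₗ Finsupp.lmapDomain ℤ ℤ (Prod.map ρ (Prod.map ρ ρ)) =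
      Finsupp.lmapDomain ℤ ℤ (Prod.map ρ ρ) ∘ₗ rackBoundary₃ Q := by
    apply Finsupp.lhom_ext'
    rintro ⟨x, y, z⟩
    apply LinearMap.ext_ring
    simp only [LinearMap.comp_apply, Finsupp.lsingle_apply, Finsupp.lmapDomain_apply,
      Finsupp.mapDomain_single, Prod.map_apply, rackBoundary₃_single, Finsupp.mapDomain_sub,
      ShelfHom.map_act]
  exact congrArg (fun g => (degenerate₂ X).mkQ ∘ₗ g) h

theorem chainMap₂_mem_ker (ρ : Q →◃ X) :
    ∀ c ∈ LinearMap.ker (quandleBoundary₂ Q), chainMap₂ ρ c ∈ LinearMap.ker (quandleBoundary₂ X) := by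
  intro c hc
  have h := LinearMap.congr_fun (quandleBoundary₂_chainMap ρ) c
  simp only [LinearMap.comp_apply, LinearMap.mem_ker.1 hc, map_zero] at h
  exact h

/-- The induced map `ρ_* : H₂^Q(Q) → H₂^Q(X)`. -/
noncomputable def inducedMap (ρ : Q →◃ X) : QuandleH₂ Q →ₗ[ℤ] QuandleH₂ X :=
  Submodule.mapQ _ _ ((chainMap₂ ρ).restrict (chainMap₂_mem_ker ρ)) (by
    rintro ⟨c, hc⟩ ⟨b, rfl⟩
    exact ⟨chainMap₃ ρ b, LinearMap.congr_fun (quandleBoundary₃_chainMap ρ) b⟩)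

/-- The homomorphism `C₂^R(X) → A` extending a map `θ : X² → A` linearly. -/
noncomputable def linearExtension {X A : Type*} [AddCommGroup A] (θ : X → X → A) : (X × X →₀ ℤ) →ₗ[ℤ] A :=
  Finsupp.lift A ℤ (X × X) fun q => θ q.1 q.2

theorem linearExtension_single {X A : Type*} [AddCommGroup A] (θ : X → X → A) (x y : X) :
    linearExtension θ (Finsupp.single (x, y) 1) = θ x y := by
  simp [linearExtension]

theorem degenerate₂_le_ker {θ : X → X → A} (hθ : IsQuandleTwoCocycle θ) :
    degenerate₂ X ≤ LinearMap.ker (linearExtension θ) := by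
  refine Submodule.span_le.2 ?_
  rintro _ ⟨x, rfl⟩
  exact (linearExtension_single θ x x).trans (hθ.self x)

/-- The homomorphism `C₂^Q(X) → A` extending a quandle 2-cocycle linearly. -/
noncomputable def cocycleChain {θ : X → X → A} (hθ : IsQuandleTwoCocycle θ) :
    QuandleChain₂ X →ₗ[ℤ] A :=
  (degenerate₂ X).liftQ (linearExtension θ) (degenerate₂_le_ker hθ)

theorem cocycleChain_comp {θ : X → X → A} (hθ : IsQuandleTwoCocycle θ) :
    cocycleChain hθ ∘ₗ quandleBoundary₃ X = 0 := by
  apply Submodule.linearMap_qext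
  have h : linearExtension θ ∘ₗ rackBoundary₃ X = 0 := by
    apply Finsupp.lhom_ext'
    rintro ⟨x, y, z⟩
    apply LinearMap.ext_ring
    simp only [LinearMap.comp_apply, Finsupp.lsingle_apply, rackBoundary₃_single, map_sub,
      linearExtension_single, LinearMap.zero_apply]
    rw [sub_sub_sub_eq, sub_eq_zero, add_comm (θ (y ◃ x) z)]
    exact (hθ.cocycle x y z).symm
  exact h

/-- The homomorphism `θ : H₂^Q(X) → A` induced by a quandle 2-cocycle. -/
noncomputable def cocycleHom {θ : X → X → A} (hθ : IsQuandleTwoCocycle θ) :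
    QuandleH₂ X →ₗ[ℤ] A :=
  Submodule.liftQ _ ((cocycleChain hθ).domRestrict (LinearMap.ker (quandleBoundary₂ X))) (by
    rintro ⟨c, hc⟩ ⟨b, rfl⟩
    exact LinearMap.congr_fun (cocycleChain_comp hθ) b)

end maps

end QuandleAlexander

open scoped Quandles

namespace QuandleAlexander

/-! ### Top-dimensional minors -/

section minors

variable {R : Type*} [CommRing R] {m n : ℕ}

/-! Write `[a]` for the monomial `1 · a`, and let `I` be the ideal on the right. Both inclusions
compare the cocycle `φ = θ ∘ ρ²` with a potential: a function `p : Q → A` whose increments `p (y ◃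
x) - p x` are `φ x y`, up to values of `φ` on cycles.

For `E_0 ≤ I`, connectedness lets `φ` be integrated along chains from a base point. The resulting
`p` is a potential up to values on cycles, so `[p]` is an exact multiplicative potential modulo `I`.
Then `∑ j, ∂_j w * [p x_j] = [p w]` modulo `I`, and the two sides of a relator have the same image
in `Q`. Hence the Alexander matrix kills a vector of units modulo `I`, and Cramer's rule forces its
maximal minors into `I` (`elementaryIdeal_zero_le`).

For `I ≤ E_0`, consider the cokernel of the matrix. The gradient descends to a map `D` from `Q` to
it with `D (y ◃ x) = [φ x y] • D x` (`exists_gradientClass`). By connectedness every `D q` is `[p q]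
• D x₀` for the first generator `x₀`, so the cokernel is cyclic. Modulo the stabilizer of `D x₀` in
`A`, this `p` is a potential, so `φ` sends cycles into the stabilizer. Each `[a] - 1` with `a` such
a value therefore annihilates a cyclic cokernel, and a triangular determinant puts it in `E_0`
(`mem_elementaryIdeal_of_span`). -/

theorem det_submatrix_mem_elementaryIdeal (M : Matrix (Fin m) (Fin n) R) (f : Fin n → Fin m) :
    (M.submatrix f id).det ∈ elementaryIdeal 0 M := by
  by_cases hf : Function.Injective f
  swap
  · obtain ⟨i, j, hij, hne⟩ : ∃ i j, f i = f j ∧ i ≠ j := by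
      simpa [Function.Injective] using hf
    rw [Matrix.det_zero_of_row_eq hne (by ext k; simp [hij])]
    exact Ideal.zero_mem _
  have hle : n ≤ m := by simpa using Fintype.card_le_of_injective f hf
  unfold elementaryIdeal
  split_ifs with h₀ h₁
  · exact Submodule.mem_top
  · omega
  -- The generators of `E_0` use rows in increasing order; sorting the chosen rows changes the
  -- determinant by a sign only.
  have hs : StrictMono (f ∘ Tuple.sort f) :=
    (Tuple.monotone_sort f).strictMono_of_injective (hf.comp (Tuple.sort f).injective)
  have hdet : (M.submatrix f id).det = ((Equiv.Perm.sign (Tuple.sort f)⁻¹ : ℤ) : R) *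
      (M.submatrix (f ∘ Tuple.sort f) id).det := by
    rw [← Matrix.det_permute]
    congr 1
    ext i j
    simp
  rw [hdet]
  refine Ideal.mul_mem_left _ _ (Ideal.subset_span ?_)
  exact ⟨OrderEmbedding.ofStrictMono _ hs, (OrderIso.refl _).toOrderEmbedding, rfl⟩

/-- A determinant whose rows are combinations of the rows of `M` lies in `E_0(M)`. -/
theorem det_mem_elementaryIdeal (M : Matrix (Fin m) (Fin n) R) (B : Matrix (Fin n) (Fin n) R)
    (hB : ∀ s, B s ∈ Submodule.span R (Set.range M)) : B.det ∈ elementaryIdeal 0 M := by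
  choose c hc using fun s => (Submodule.mem_span_range_iff_exists_fun R).1 (hB s)
  -- Multilinear expansion: choose one row of `M` for each row of `B`. Repeated choices are allowed
  -- and give zero minors.
  have hdet : B.det = ∑ f : Fin n → Fin m, (∏ s, c s (f s)) * (M.submatrix f id).det := by
    have hBc : B = fun s => ∑ i, c s i • M i := funext fun s => (hc s).symm
    change Matrix.detRowAlternating.toMultilinearMap B = _
    rw [hBc, MultilinearMap.map_sum]
    refine Finset.sum_congr rfl fun f _ => ?_
    rw [MultilinearMap.map_smul_univ]
    rfl
  rw [hdet]
  exact Ideal.sum_mem _ fun f _ =>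
    Ideal.mul_mem_left _ _ (det_submatrix_mem_elementaryIdeal M f)

/-- The hypotheses say that the first basis vector generates the cokernel and is killed by `b`;
these `n` relations alone have determinant `b`. -/
theorem mem_elementaryIdeal_of_span (hn : 0 < n) (M : Matrix (Fin m) (Fin n) R) (u : Fin n → R)
    (hu : ∀ s, Pi.single s 1 - u s • Pi.single ⟨0, hn⟩ 1 ∈ Submodule.span R (Set.range M))
    (b : R) (hb : b • Pi.single ⟨0, hn⟩ 1 ∈ Submodule.span R (Set.range M)) :
    b ∈ elementaryIdeal 0 M := by
  set s₀ : Fin n := ⟨0, hn⟩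
  -- Because `s₀` is the least index, this matrix is lower triangular, with diagonal `b, 1, …, 1`.
  let B : Matrix (Fin n) (Fin n) R := fun s =>
    if s = s₀ then b • Pi.single s₀ 1 else Pi.single s 1 - u s • Pi.single s₀ 1
  have hBdet : B.det = b := by
    rw [Matrix.det_of_isLowerTriangular, Finset.prod_eq_single s₀]
    · simp [B]
    · intro s _ hs
      simp [B, hs]
    · simp
    · intro i j hij
      have hij' : i < j := hij
      have hj : j ≠ s₀ := by
        rintro rfl
        exact absurd hij' (Nat.not_lt_zero _)
      by_cases hi : i = s₀
      · simp [B, hi, hj]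
      · simp [B, hi, hj, hij'.ne']
  rw [← hBdet]
  refine det_mem_elementaryIdeal M B fun s => ?_
  by_cases hs : s = s₀
  · simpa [B, hs] using hb
  · simpa [B, hs] using hu s

/-- Cramer's rule: if a square matrix kills `v`, so does its determinant, and one unit entry of `v`
then makes the determinant zero in the quotient. -/
theorem elementaryIdeal_zero_le (hn : 0 < n) (M : Matrix (Fin m) (Fin n) R) (I : Ideal R)
    (v : Fin n → R ⧸ I) (hv : ∀ s, IsUnit (v s))
    (hM : ∀ i, ∑ j, Ideal.Quotient.mk I (M i j) * v j = 0) : elementaryIdeal 0 M ≤ I := by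
  unfold elementaryIdeal
  split_ifs with h₀ h₁
  · omega
  · exact bot_le
  refine Ideal.span_le.2 ?_
  rintro _ ⟨r, c, rfl⟩
  -- A maximal minor uses every column, and the only increasing self-map of `Fin n` is the identity.
  have hc : ⇑c = id := (c.strictMono.range_inj (β := Fin n) strictMono_id).1 <| by
    rw [Set.range_id]
    exact (Finite.injective_iff_surjective.1 (show Function.Injective (c : Fin n → Fin n) from
      c.injective)).range_eq
  rw [SetLike.mem_coe, ← Ideal.Quotient.eq_zero_iff_mem, RingHom.map_det, hc]
  set B : Matrix (Fin n) (Fin n) (R ⧸ I) := (Ideal.Quotient.mk I).mapMatrix (M.submatrix r id)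
  have hBv : B.mulVec v = 0 := funext fun i => hM (r i)
  have h : B.det • v = 0 := by
    rw [← Matrix.one_mulVec v, ← Matrix.smul_mulVec, ← Matrix.adjugate_mul,
      ← Matrix.mulVec_mulVec, hBv, Matrix.mulVec_zero]
  exact (hv ⟨0, hn⟩).mul_left_eq_zero.1 (congrFun h ⟨0, hn⟩)

end minors

/-! ### Connected quandles and presentations -/

theorem IsConnected.induction {Q : Type*} [Quandle Q] (hQ : IsConnected Q) {p : Q → Prop} (x : Q)
    (hx : p x) (act : ∀ y a, p a → p (y ◃ a)) (invAct : ∀ y a, p a → p (y ◃⁻¹ a)) (y : Q) :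
    p y := by
  obtain ⟨l, rfl⟩ := hQ x y
  induction l generalizing x with
  | nil => exact hx
  | cons z l ih =>
    refine ih _ ?_
    dsimp only
    split_ifs
    exacts [act _ _ hx, invAct _ _ hx]

theorem FreeQuandle.induction {S : Type*} {p : FreeQuandle S → Prop} (of : ∀ s, p (.of s))
    (act : ∀ y x, p y → p x → p (y ◃ x)) (invAct : ∀ y x, p y → p x → p (y ◃⁻¹ x)) (w) : p w := by
  obtain ⟨w⟩ := w
  induction w with
  | of s => exact of s
  | act y x ihy ihx => exact act _ _ ihy ihx
  | invAct y x ihy ihx => exact invAct _ _ ihy ihx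

namespace FinitePresentation

variable {Q : Type*} [Quandle Q] (P : FinitePresentation Q)

theorem lift_gen (w : FreeQuandle (Fin P.n)) :
    FreeQuandle.lift P.gen w = P.iso (Quotient.mk (relatorSetoid P.rel) w) := by
  let F : FreeQuandle (Fin P.n) →◃ Q :=
    ⟨fun w => P.iso (Quotient.mk (relatorSetoid P.rel) w), fun {y x} =>
      P.map_act (Quotient.mk (relatorSetoid P.rel) y) (Quotient.mk (relatorSetoid P.rel) x)⟩
  have h : FreeQuandle.lift P.gen = F := FreeQuandle.hom_ext fun _ => rfl
  exact DFunLike.congr_fun h w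

theorem lift_gen_eq_iff {w w' : FreeQuandle (Fin P.n)} :
    FreeQuandle.lift P.gen w = FreeQuandle.lift P.gen w' ↔ RelatorCongr P.rel w w' := by
  rw [P.lift_gen, P.lift_gen]
  exact P.iso.apply_eq_iff_eq.trans Quotient.eq

theorem lift_gen_surjective : Function.Surjective (FreeQuandle.lift P.gen) := by
  intro q
  obtain ⟨w, hw⟩ := Quotient.exists_rep (P.iso.symm q)
  exact ⟨w, by rw [P.lift_gen, hw, P.iso.apply_symm_apply]⟩

/-- Every quandle word contains a letter, so the free quandle on no generators is empty. -/
theorem n_pos [Nonempty Q] : 0 < P.n := by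
  obtain ⟨w, -⟩ := P.lift_gen_surjective (Classical.arbitrary Q)
  exact FreeQuandle.induction (p := fun _ => 0 < P.n) (fun s => s.pos) (fun _ _ h _ => h)
    (fun _ _ h _ => h) w

end FinitePresentation

/-! ### Cycles and the image of the cocycle -/

section cycles

variable {Q X A : Type*} [Quandle Q] [Quandle X] [AddCommGroup A]

theorem linearExtension_comp (θ : X → X → A) (ρ : Q →◃ X) (c : Q × Q →₀ ℤ) :
    linearExtension θ (Finsupp.lmapDomain ℤ ℤ (Prod.map ρ ρ) c) =
      linearExtension (fun x y => θ (ρ x) (ρ y)) c := by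
  suffices h : linearExtension θ ∘ₗ Finsupp.lmapDomain ℤ ℤ (Prod.map ρ ρ) =
      linearExtension (fun x y => θ (ρ x) (ρ y)) from LinearMap.congr_fun h c
  apply Finsupp.lhom_ext'
  rintro ⟨x, y⟩
  apply LinearMap.ext_ring
  simp [linearExtension_single]

/-- The image of `θ ∘ ρ_*` consists of the values of `θ ∘ ρ²` on the rack cycles. -/
theorem mem_range_cocycleHom_comp_inducedMap {θ : X → X → A} (hθ : IsQuandleTwoCocycle θ)
    (ρ : Q →◃ X) {a : A} :
    a ∈ Set.range (cocycleHom hθ ∘ inducedMap ρ) ↔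
      ∃ c, rackBoundary₂ Q c = 0 ∧ linearExtension (fun x y => θ (ρ x) (ρ y)) c = a := by
  constructor
  -- Degenerate chains have zero boundary already in the rack complex, so any lift of a quandle
  -- cycle is a rack cycle.
  · rintro ⟨h, rfl⟩
    obtain ⟨⟨c, hc⟩, rfl⟩ := Submodule.Quotient.mk_surjective _ h
    obtain ⟨c, rfl⟩ := Submodule.Quotient.mk_surjective _ c
    exact ⟨c, hc, (linearExtension_comp θ ρ c).symm⟩
  · rintro ⟨c, hc, rfl⟩
    exact ⟨Submodule.Quotient.mk ⟨Submodule.Quotient.mk c, hc⟩, linearExtension_comp θ ρ c⟩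

/-- A word carrying `x` to `y` is a path, and each step from `a` to `y ◃ a` contributes the chain
`(a, y)`; an inverse step is traversed backwards, hence the minus sign. -/
theorem IsConnected.exists_boundary (hQ : IsConnected Q) (x y : Q) :
    ∃ c, rackBoundary₂ Q c = Finsupp.single x 1 - Finsupp.single y 1 := by
  refine hQ.induction (p := fun y => ∃ c, rackBoundary₂ Q c = Finsupp.single x 1 -
    Finsupp.single y 1) x ⟨0, by simp⟩ ?_ ?_ y
  · rintro y a ⟨c, hc⟩
    exact ⟨c + Finsupp.single (a, y) 1, by rw [map_add, hc, rackBoundary₂_single]; abel⟩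
  · rintro y a ⟨c, hc⟩
    refine ⟨c - Finsupp.single (y ◃⁻¹ a, y) 1, ?_⟩
    rw [map_sub, hc, rackBoundary₂_single, Rack.right_inv]
    abel

/-- On a connected quandle a map `Q² → A` is a coboundary up to its values on cycles. -/
theorem IsConnected.exists_potential (hQ : IsConnected Q) [Nonempty Q] (φ : Q → Q → A) :
    ∃ p : Q → A, ∀ x y, ∃ c, rackBoundary₂ Q c = 0 ∧
      p (y ◃ x) = p x + φ x y + linearExtension φ c := by
  choose c hc using hQ.exists_boundary (Classical.arbitrary Q)
  -- The potential is the integral of `φ` along the chosen chain to `x`; the error is its value on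
  -- the loop formed by the two chains and the edge `(x, y)`.
  refine ⟨fun x => linearExtension φ (c x), fun x y =>
    ⟨c (y ◃ x) - c x - Finsupp.single (x, y) 1, ?_, ?_⟩⟩
  · rw [map_sub, map_sub, hc, hc, rackBoundary₂_single]
    abel
  · rw [map_sub, map_sub, linearExtension_single]
    abel

/-- If `φ` is a coboundary modulo `K`, then its values on cycles are in `K`. -/
theorem linearExtension_mem_of_potential (φ : Q → Q → A) (K : AddSubgroup A) (p : Q → A)
    (hp : ∀ x y, p x + φ x y - p (y ◃ x) ∈ K) {c : Q × Q →₀ ℤ} (hc : rackBoundary₂ Q c = 0) :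
    linearExtension φ c ∈ K := by
  -- For arbitrary chains the correct statement adds `p ∘ ∂₂`. It is linear, so it may be checked on
  -- generators, and the extra term vanishes on cycles.
  have key : ∀ c : Q × Q →₀ ℤ, linearExtension φ c +
      Finsupp.lift A ℤ Q p (rackBoundary₂ Q c) ∈ K := by
    intro c
    induction c using Finsupp.induction_linear with
    | zero => simp
    | add f g hf hg =>
      have := K.add_mem hf hg
      rw [map_add, map_add, map_add, add_add_add_comm]
      exact this
    | single q k =>
      obtain ⟨x, y⟩ := q
      have h : Finsupp.single (x, y) k = k • Finsupp.single (x, y) (1 : ℤ) := by simp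
      rw [h, map_smul, map_smul, map_smul, ← smul_add]
      refine K.zsmul_mem ?_ k
      rw [linearExtension_single, rackBoundary₂_single, map_sub]
      have e : ∀ z, Finsupp.lift A ℤ Q p (Finsupp.single z 1) = p z := by simp
      rw [e, e]
      convert hp x y using 1
      abel
  simpa [hc] using key c

end cycles

/-! ### The derivatives for the Alexander pair of a 2-cocycle -/

section monomials

variable {A : Type*} [AddCommGroup A]

theorem single_add_one (a b : A) : (AddMonoidAlgebra.single (a + b) 1 : AddMonoidAlgebra ℤ A) =
    AddMonoidAlgebra.single a 1 * AddMonoidAlgebra.single b 1 := by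
  rw [AddMonoidAlgebra.single_mul_single, mul_one]

theorem single_neg_mul_single (a : A) : (AddMonoidAlgebra.single (-a) 1 *
    AddMonoidAlgebra.single a 1 : AddMonoidAlgebra ℤ A) = 1 := by
  rw [← single_add_one, neg_add_cancel]
  rfl

theorem isUnit_single_one (a : A) :
    IsUnit (AddMonoidAlgebra.single a 1 : AddMonoidAlgebra ℤ A) :=
  .of_mul_eq_one_right _ (single_neg_mul_single a)

end monomials

section cocycleDerivative

variable {Q X A : Type*} [Quandle Q] [Quandle X] [AddCommGroup A] {θ : X → X → A}
  (P : FinitePresentation Q) (hθ : IsQuandleTwoCocycle θ) (ρ : Q →◃ X)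

/-- The gradient `(∂w/∂x_1, …, ∂w/∂x_n)` for the pair `(f_θ, 0)` pulled back along `ρ`. -/
noncomputable def gradient (w : FreeQuandle (Fin P.n)) : Fin P.n → AddMonoidAlgebra ℤ A :=
  fun j => derivative ((cocyclePair hθ).comp ρ) P.gen j w

theorem gradient_of (s : Fin P.n) : gradient P hθ ρ (.of s) = Pi.single s 1 := by
  funext j
  rw [gradient, derivative_of, Pi.single_apply]
  simp only [eq_comm]

theorem gradient_act (y x : FreeQuandle (Fin P.n)) :
    gradient P hθ ρ (y ◃ x) = (AddMonoidAlgebra.single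
      (θ (ρ (FreeQuandle.lift P.gen x)) (ρ (FreeQuandle.lift P.gen y))) 1 : AddMonoidAlgebra ℤ A) •
        gradient P hθ ρ x := by
  funext j
  refine (derivative_act _ _ _ _ _).trans ?_
  simp only [AlexanderPair.comp, cocyclePair, zero_mul, add_zero]
  rfl

theorem alexanderMatrix_row (i : Fin P.m) :
    alexanderMatrix P ρ (cocyclePair hθ) i =
      gradient P hθ ρ (P.rel i).1 - gradient P hθ ρ (P.rel i).2 := rfl

/-- The row space of the Alexander matrix. -/
noncomputable def rowSpace : Submodule (AddMonoidAlgebra ℤ A) (Fin P.n → AddMonoidAlgebra ℤ A) :=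
  Submodule.span _ (Set.range (alexanderMatrix P ρ (cocyclePair hθ)))

/-- The class of the gradient modulo the rows of the Alexander matrix. -/
noncomputable def gradientClass (w : FreeQuandle (Fin P.n)) :
    (Fin P.n → AddMonoidAlgebra ℤ A) ⧸ rowSpace P hθ ρ :=
  Submodule.Quotient.mk (gradient P hθ ρ w)

theorem gradientClass_act (y x : FreeQuandle (Fin P.n)) :
    gradientClass P hθ ρ (y ◃ x) = (AddMonoidAlgebra.single
      (θ (ρ (FreeQuandle.lift P.gen x)) (ρ (FreeQuandle.lift P.gen y))) 1 : AddMonoidAlgebra ℤ A) •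
        gradientClass P hθ ρ x := by
  rw [gradientClass, gradient_act]
  rfl

/-- Relators are identified by the rows themselves. The congruence rules respect classes because the
second map of the pair is zero and the coefficient of `∂x` depends only on images in `Q`. -/
theorem gradientClass_congr {w w' : FreeQuandle (Fin P.n)} (h : RelatorCongr P.rel w w') :
    gradientClass P hθ ρ w = gradientClass P hθ ρ w' := by
  induction h with
  | rel i => exact (Submodule.Quotient.eq _).2 (Submodule.subset_span ⟨i, rfl⟩)
  | refl => rfl
  | symm _ ih => exact ih.symm
  | trans _ _ ih ih' => exact ih.trans ih'
  | act_congr hy hx _ ihx =>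
    rw [gradientClass_act, gradientClass_act, ihx, P.lift_gen_eq_iff.2 hy, P.lift_gen_eq_iff.2 hx]
  | @invAct_congr y y' x x' hy hx _ ihx =>
    -- Acting by `y` undoes the inverse action and multiplies by a monomial, which is a unit and
    -- cancels.
    have h := ihx
    rw [← Rack.right_inv y x, ← Rack.right_inv y' x', gradientClass_act, gradientClass_act,
      P.lift_gen_eq_iff.2 hy, P.lift_gen_eq_iff.2 (hy.invAct_congr hx)] at h
    exact (isUnit_single_one _).smul_left_cancel.1 h

theorem exists_gradientClass :
    ∃ D : Q → (Fin P.n → AddMonoidAlgebra ℤ A) ⧸ rowSpace P hθ ρ,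
      (∀ s, D (P.gen s) = Submodule.Quotient.mk (Pi.single s 1)) ∧
      ∀ y x, D (y ◃ x) =
        (AddMonoidAlgebra.single (θ (ρ x) (ρ y)) 1 : AddMonoidAlgebra ℤ A) • D x := by
  have hσ := Function.surjInv_eq P.lift_gen_surjective
  refine ⟨fun q => gradientClass P hθ ρ (Function.surjInv P.lift_gen_surjective q),
    fun s => ?_, fun y x => ?_⟩
  · rw [← gradient_of P hθ ρ s]
    exact gradientClass_congr P hθ ρ (P.lift_gen_eq_iff.1 (hσ _))
  · have h := gradientClass_act P hθ ρ (Function.surjInv P.lift_gen_surjective y)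
      (Function.surjInv P.lift_gen_surjective x)
    rw [hσ, hσ] at h
    rw [← h]
    refine gradientClass_congr P hθ ρ (P.lift_gen_eq_iff.1 ?_)
    rw [hσ, ShelfHom.map_act, hσ, hσ]

theorem sub_mem_elementaryIdeal [Nonempty Q] (hQ : IsConnected Q) {c : Q × Q →₀ ℤ}
    (hc : rackBoundary₂ Q c = 0) :
    (AddMonoidAlgebra.single (linearExtension (fun x y => θ (ρ x) (ρ y)) c) 1 -
      AddMonoidAlgebra.single 0 1 : AddMonoidAlgebra ℤ A) ∈
        elementaryIdeal 0 (alexanderMatrix P ρ (cocyclePair hθ)) := by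
  obtain ⟨D, hgen, hact⟩ := exists_gradientClass P hθ ρ
  set s₀ : Fin P.n := ⟨0, P.n_pos⟩
  -- Connectedness makes the cokernel cyclic, with monomial coefficients.
  have hpot : ∀ q, ∃ a : A,
      D q = (AddMonoidAlgebra.single a 1 : AddMonoidAlgebra ℤ A) • D (P.gen s₀) := by
    refine hQ.induction (P.gen s₀) ⟨0, (one_smul _ _).symm⟩ ?_ ?_
    · rintro y x ⟨a, ha⟩
      exact ⟨θ (ρ x) (ρ y) + a, by rw [hact, ha, smul_smul, single_add_one]⟩
    · rintro y x ⟨a, ha⟩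
      refine ⟨-θ (ρ (y ◃⁻¹ x)) (ρ y) + a, ?_⟩
      rw [single_add_one, ← smul_smul, ← ha]
      conv_rhs => rw [← Rack.right_inv y x]
      rw [hact, smul_smul, Rack.right_inv, single_neg_mul_single, one_smul]
  choose p hp using hpot
  -- The exponents `p q` are determined only modulo this stabilizer, so `p` need only be a potential
  -- modulo `K`.
  let K : AddSubgroup A :=
    { carrier := {a | (AddMonoidAlgebra.single a 1 : AddMonoidAlgebra ℤ A) • D (P.gen s₀) =
        D (P.gen s₀)}
      zero_mem' := one_smul _ _
      add_mem' := fun {a b} ha hb => by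
        rw [Set.mem_ofPred_eq] at *
        rw [single_add_one, ← smul_smul, hb, ha]
      neg_mem' := fun {a} ha => by
        rw [Set.mem_ofPred_eq] at *
        conv_lhs => rw [← ha]
        rw [smul_smul, single_neg_mul_single, one_smul] }
  have hK : linearExtension (fun x y => θ (ρ x) (ρ y)) c ∈ K := by
    refine linearExtension_mem_of_potential _ K p (fun x y => ?_) hc
    change (AddMonoidAlgebra.single _ 1 : AddMonoidAlgebra ℤ A) • D (P.gen s₀) = D (P.gen s₀)
    have h := hact y x
    rw [hp x, smul_smul, ← single_add_one, hp (y ◃ x)] at h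
    rw [sub_eq_neg_add, single_add_one, add_comm (p x), ← smul_smul, ← h, smul_smul,
      single_neg_mul_single, one_smul]
  refine mem_elementaryIdeal_of_span P.n_pos _
    (fun s => AddMonoidAlgebra.single (p (P.gen s)) 1) (fun s => ?_) _ ?_
  · refine (Submodule.Quotient.eq (rowSpace P hθ ρ)).1 ?_
    rw [← hgen, hp, hgen, Submodule.Quotient.mk_smul]
  · refine (Submodule.Quotient.mk_eq_zero (rowSpace P hθ ρ)).1 ?_
    rw [Submodule.Quotient.mk_smul, ← hgen, sub_smul, sub_eq_zero]
    exact hK.trans (one_smul _ _).symm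

/-- Potentials with values in the units of a quotient ring integrate gradients. -/
theorem sum_gradient_mul {I : Ideal (AddMonoidAlgebra ℤ A)} (p : Q → A)
    (hp : ∀ y x, Ideal.Quotient.mk I (AddMonoidAlgebra.single (p (y ◃ x)) 1) =
      Ideal.Quotient.mk I (AddMonoidAlgebra.single (θ (ρ x) (ρ y)) 1) *
        Ideal.Quotient.mk I (AddMonoidAlgebra.single (p x) 1)) (w : FreeQuandle (Fin P.n)) :
    ∑ j, Ideal.Quotient.mk I (gradient P hθ ρ w j) *
        Ideal.Quotient.mk I (AddMonoidAlgebra.single (p (P.gen j)) 1) =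
      Ideal.Quotient.mk I (AddMonoidAlgebra.single (p (FreeQuandle.lift P.gen w)) 1) := by
  have hact : ∀ y x : FreeQuandle (Fin P.n),
      ∑ j, Ideal.Quotient.mk I (gradient P hθ ρ (y ◃ x) j) *
        Ideal.Quotient.mk I (AddMonoidAlgebra.single (p (P.gen j)) 1) =
      Ideal.Quotient.mk I (AddMonoidAlgebra.single
        (θ (ρ (FreeQuandle.lift P.gen x)) (ρ (FreeQuandle.lift P.gen y))) 1) *
      ∑ j, Ideal.Quotient.mk I (gradient P hθ ρ x j) *
        Ideal.Quotient.mk I (AddMonoidAlgebra.single (p (P.gen j)) 1) := by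
    intro y x
    simp only [gradient_act, Pi.smul_apply, smul_eq_mul, map_mul, mul_assoc, Finset.mul_sum]
  induction w using FreeQuandle.induction with
  | of s =>
    rw [gradient_of, Finset.sum_eq_single s]
    · simp [FreeQuandle.lift_of]
    · intro j _ hj
      simp [hj]
    · simp
  | act y x _ ihx => rw [hact, ihx, ShelfHom.map_act, hp]
  -- Multiply by the unit coefficient of acting by `y`, which reduces the claim to the one for `x`.
  | invAct y x _ ihx =>
    refine ((isUnit_single_one (θ (ρ (FreeQuandle.lift P.gen (y ◃⁻¹ x)))
      (ρ (FreeQuandle.lift P.gen y)))).map (Ideal.Quotient.mk I)).mul_left_cancel ?_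
    rw [← hact y, Rack.right_inv, ihx, ← hp, ← ShelfHom.map_act, Rack.right_inv]

end cocycleDerivative

end QuandleAlexander

theorem theorem5p1 {Q X A : Type*} [Quandle Q] [Nonempty Q] [Quandle X] [AddCommGroup A]
    (P : QuandleAlexander.FinitePresentation Q) (hQ : QuandleAlexander.IsConnected Q)
    {θ : X → X → A} (hθ : QuandleAlexander.IsQuandleTwoCocycle θ) (ρ : Q →◃ X) :
    QuandleAlexander.elementaryIdeal 0
        (QuandleAlexander.alexanderMatrix P ρ (QuandleAlexander.cocyclePair hθ)) =
      Ideal.span {x : AddMonoidAlgebra ℤ A |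
        ∃ a ∈ Set.range
            (QuandleAlexander.cocycleHom hθ ∘ QuandleAlexander.inducedMap ρ),
          x = AddMonoidAlgebra.single a 1 - AddMonoidAlgebra.single 0 1} := by
  have hval : ∀ c, QuandleAlexander.rackBoundary₂ Q c = 0 →
      (AddMonoidAlgebra.single (QuandleAlexander.linearExtension (fun x y => θ (ρ x) (ρ y)) c) 1 -
        AddMonoidAlgebra.single 0 1 : AddMonoidAlgebra ℤ A) ∈
      Ideal.span {x : AddMonoidAlgebra ℤ A |
        ∃ a ∈ Set.range
            (QuandleAlexander.cocycleHom hθ ∘ QuandleAlexander.inducedMap ρ),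
          x = AddMonoidAlgebra.single a 1 - AddMonoidAlgebra.single 0 1} := fun c hc =>
    Ideal.subset_span
      ⟨_, (QuandleAlexander.mem_range_cocycleHom_comp_inducedMap hθ ρ).2 ⟨c, hc, rfl⟩, rfl⟩
  apply le_antisymm
  · obtain ⟨p, hp⟩ := hQ.exists_potential fun x y => θ (ρ x) (ρ y)
    refine QuandleAlexander.elementaryIdeal_zero_le P.n_pos _ _
      (fun j => Ideal.Quotient.mk _ (AddMonoidAlgebra.single (p (P.gen j)) 1))
      (fun j => (QuandleAlexander.isUnit_single_one _).map _) fun i => ?_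
    -- The defect of the potential is a value of the cocycle on a cycle, and its monomial is `1`
    -- modulo the ideal.
    have hgrad := QuandleAlexander.sum_gradient_mul P hθ ρ p (I := Ideal.span _) fun y x => by
      obtain ⟨c, hc, h⟩ := hp x y
      rw [h, QuandleAlexander.single_add_one, QuandleAlexander.single_add_one, map_mul, map_mul,
        Ideal.Quotient.mk_eq_mk_iff_sub_mem _ _ |>.2 (hval c hc)]
      exact (mul_one _).trans (mul_comm _ _)
    simp only [QuandleAlexander.alexanderMatrix_row, Pi.sub_apply, map_sub, sub_mul,
      Finset.sum_sub_distrib, hgrad]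
    -- Row `i` pairs to the difference of the potential monomials at the two sides of the relator,
    -- which are the same point of `Q`.
    rw [P.lift_gen_eq_iff.2 (.rel i), sub_self]
  · refine Ideal.span_le.2 ?_
    rintro _ ⟨a, ha, rfl⟩
    obtain ⟨c, hc, rfl⟩ := (QuandleAlexander.mem_range_cocycleHom_comp_inducedMap hθ ρ).1 ha
    exact QuandleAlexander.sub_mem_elementaryIdeal P hθ ρ hQ hc
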